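/- Let $n\ge 0$ and let the keys be $[n]$. A binary search tree (BST) $R$ on $[n]$ contains every key exactly once; $d_R(i)$ is the depth of $i$ in $R$, i.e. its distance from the root (so the root has depth $0$). For an access sequence $S=(s_1,\dots,s_m)\in[n]^m$ put $SO_R(S)=\sum_{j=1}^m d_R(s_j)$ and $SO(S)=\min_R SO_R(S)$, the minimum over all BSTs $R$ on $[n]$. A configuration is a finite set $P$ of points (key, time) with integer times $\geq 0$. Suppose that all times in $P$ are smaller than $t$ and that key $s$ is accessed at time $t$. Greedy touches $s$ and every key $y\ne s$ for which some point $(y,t')\in P$ is such that the closed axis-parallel rectangle with opposite corners $(s,t)$ and $(y,t')$ contains no point of $P\cup\{(s,t)\}$ other than these two corners. The new configuration is $P'=P\cup\{(y,t): y\text{ touched}\}$, and the cost of the access is the number of touched keys. A sequence $S$ is served from $P$ by accessing $s_1,s_2,\dots$ at the times $t,t+1,\dots$. In a configuration $P$ the neighborhood $T(x)$ of a key $x$ is the largest interval of keys containing $x$ in which every key other than $x$ was last touched strictly before the last time at which $x$ was touched (a never touched key counts as touched at time $-\infty$). For a reference BST $R$ on $[n]$ the min-depth potential of $x$ is $\phi(x)=-2\min_{j\in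 T(x)}d_R(j)$, and $\phi(P)=\sum_{x\in[n]}\phi(x)$. There is an absolute constant $C$ such that the following holds for all $n$. 1. For every BST $R$ on $[n]$, every configuration $P$ all of whose times are smaller than $t$, and every key $s$ accessed at time $t$, the amortized cost of the access satisfies $$\#\{\text{touched keys}\}+\phi(P')-\phi(P)\le C\,(1+d_R(s)).$$ Moreover, if $x_{-l}<\dots<x_{-1}<x_0=s<x_1<\dots<x_r$ are the touched keys and $\phi,\phi'$ are the potentials of keys before and after the access (with respect to $P$ and $P'$), then $$2+\phi'(x_i)+\phi'(x_{i+2})\le 2\phi(x_{i+3})\quad(0\le i\le r-3),$$ and symmetrically $2+\phi'(x_{-i})+\phi'(x_{-i-2})\le 2\phi(x_{-i-3})$ for $0\le i\le l-3$. 2. (Static optimality.) For every BST $R$ on $[n]$ and every $S\in[n]^m$, the total cost of Greedy for serving $S$ from any configuration $P$ with all times smaller than the starting time is at most $C\,(m+SO_R(S))+2\sum_{x\in[n]}d_R(x)$. When served from the empty configuration, its total cost is at most $C\,(m+SO(S))$. -/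

import Mathlib

/-! ### Binary search trees on the key set `Fin n` -/

/-- The set of keys stored in a binary tree. -/
def treeKeys {n : ℕ} : BinaryTree (Fin n) → Finset (Fin n)
  | .nil => ∅
  | .node a l r => insert a (treeKeys l ∪ treeKeys r)

/-- The search tree property at every node. -/
def SearchOrdered {n : ℕ} : BinaryTree (Fin n) → Prop
  | .nil => True
  | .node a l r =>
      (∀ x ∈ treeKeys l, x < a) ∧ (∀ x ∈ treeKeys r, a < x) ∧ SearchOrdered l ∧ SearchOrdered r

/-- `R` is a binary search tree whose key set is all of `Fin n`. -/
def IsBSTOn (n : ℕ) (R : BinaryTree (Fin n)) : Prop :=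
  SearchOrdered R ∧ treeKeys R = Finset.univ

/-- The depth of the key `k`: the number of edges on the search path from the root to `k`
(the root has depth `0`; the value for a key that is not stored is irrelevant). -/
def keyDepth {n : ℕ} : BinaryTree (Fin n) → Fin n → ℕ
  | .nil, _ => 0
  | .node a l r, k =>
      if k = a then 0 else if k < a then keyDepth l k + 1 else keyDepth r k + 1

/-- The total depth `SO_R(S) = ∑ d_R(s_j)` of the accesses in the static tree `R`. -/
def staticCost {n : ℕ} (R : BinaryTree (Fin n)) (S : List (Fin n)) : ℕ :=
  (S.map (keyDepth R)).sum

/-- The static optimality bound `SO(S)`: the minimum of `SO_R(S)` over all binary search trees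
`R` on the key set. -/
noncomputable def staticOpt {n : ℕ} (S : List (Fin n)) : ℕ :=
  sInf {c | ∃ R : BinaryTree (Fin n), IsBSTOn n R ∧ c = staticCost R S}

/-! ### Greedy in the geometric view

A configuration is a finite set of points `(key, time)`. -/

/-- The closed axis-parallel rectangle with opposite corners `p` and `q` contains `u`. -/
def InRect {n : ℕ} (p q u : Fin n × ℕ) : Prop :=
  min p.1 q.1 ≤ u.1 ∧ u.1 ≤ max p.1 q.1 ∧ min p.2 q.2 ≤ u.2 ∧ u.2 ≤ max p.2 q.2

instance {n : ℕ} (p q u : Fin n × ℕ) : Decidable (InRect p q u) :=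
  inferInstanceAs (Decidable (_ ∧ _ ∧ _ ∧ _))

/-- The keys touched by Greedy when `s` is accessed at time `t` and `P` is the set of earlier
points: `s` itself, and every key `y` such that some point `(y, t')` of `P` spans with the access
point `(s, t)` an unsatisfied rectangle, that is, one of nonzero width that contains no point
other than these two corners. -/
def greedyTouched {n : ℕ} (P : Finset (Fin n × ℕ)) (t : ℕ) (s : Fin n) :
    Finset (Fin n) :=
  Finset.univ.filter fun y =>
    y = s ∨ ∃ p ∈ P, p.1 = y ∧ y ≠ s ∧
      ∀ u ∈ insert (s, t) P, InRect (s, t) p u → u = (s, t) ∨ u = p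

/-- The configuration after Greedy has served the access to `s` at time `t`. -/
def greedyStep {n : ℕ} (P : Finset (Fin n × ℕ)) (t : ℕ) (s : Fin n) :
    Finset (Fin n × ℕ) :=
  P ∪ (greedyTouched P t s).image fun y => (y, t)

/-- The cost of Greedy (number of touched points) for serving the accesses `S` one after another
at the times `t, t + 1, …`, starting from the configuration `P`. -/
def greedyCost {n : ℕ} : Finset (Fin n × ℕ) → ℕ → List (Fin n) → ℕ
  | _, _, [] => 0
  | P, t, s :: S => (greedyTouched P t s).card + greedyCost (greedyStep P t s) (t + 1) S

/-- The touched keys `x₀ = s < x₁ < … < x_r` to the right of the accessed key, in order. -/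
def touchedRight {n : ℕ} (P : Finset (Fin n × ℕ)) (t : ℕ) (s : Fin n) :
    List (Fin n) :=
  ((greedyTouched P t s).filter fun y => s ≤ y).sort (fun a b => a ≤ b)

/-- The touched keys `x₀ = s > x₋₁ > … > x₋ₗ` to the left of the accessed key, listed by
increasing distance from `s`. -/
def touchedLeft {n : ℕ} (P : Finset (Fin n × ℕ)) (t : ℕ) (s : Fin n) :
    List (Fin n) :=
  ((greedyTouched P t s).filter fun y => y ≤ s).sort (fun a b => a ≥ b)

/-! ### Neighborhoods and the min-depth potential -/

/-- The last time at which the key `y` was touched; `⊥` if it was never touched. -/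
def lastTouch {n : ℕ} (P : Finset (Fin n × ℕ)) (y : Fin n) : WithBot ℕ :=
  ((P.filter fun p => p.1 = y).image Prod.snd).max

/-- The neighborhood of the key `x`: the largest interval of keys around `x` in which every key
other than `x` was last touched strictly before `x` was last touched. -/
def neighborhood {n : ℕ} (P : Finset (Fin n × ℕ)) (x : Fin n) : Finset (Fin n) :=
  Finset.univ.filter fun z =>
    ∀ y, min x z ≤ y → y ≤ max x z → y ≠ x → lastTouch P y < lastTouch P x

theorem neighborhood_nonempty {n : ℕ} (P : Finset (Fin n × ℕ)) (x : Fin n) :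
    (neighborhood P x).Nonempty := by
  refine ⟨x, ?_⟩
  simp only [neighborhood, Finset.mem_filter, Finset.mem_univ, true_and, min_self, max_self]
  intro y h1 h2 h3
  exact absurd (le_antisymm h2 h1) h3

/-- The min-depth potential `φ(x) = -2 · min {d_R(j) : j in the neighborhood of x}` of a key. -/
def keyPotential {n : ℕ} (R : BinaryTree (Fin n)) (P : Finset (Fin n × ℕ))
    (x : Fin n) : ℤ :=
  -2 * ((neighborhood P x).inf' (neighborhood_nonempty P x) (keyDepth R) : ℕ)

/-- The min-depth potential of a configuration. -/
def minDepthPotential {n : ℕ} (R : BinaryTree (Fin n))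
    (P : Finset (Fin n × ℕ)) : ℤ :=
  ∑ x, keyPotential R P x

/-! ### Depths in a binary search tree -/

/-! A key is touched exactly when its last touch is a strict record seen from `s`
(`mem_greedyTouched_iff`), so the old neighborhood of a touched key b contains everything from `s`
to b. After the access all touched keys share the time `t`, so no new neighborhood of a touched key
crosses another touched key. For consecutive touched keys a, m, c, b moving away from `s`, m
therefore separates the new neighborhoods of a and c, and their depth minimizers p ≠ q both lie in
the old neighborhood of b. If p and q have equal depth, a shallower key lies between them; either
way d(p) + d(q) exceeds twice the old minimum of b, which is `keyPotential_inequality`.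

Summed over one side of `s`, each new potential is used twice, so all but boundedly many terms
cancel. The rest cost O(1 + d(s)), because `s` lies in the old neighborhood of every touched key.
Untouched keys only lose neighborhood, so their potential does not increase. Static optimality
follows by summing over the accesses. -/

theorem exists_bst_of_finset {n : ℕ} (s : Finset (Fin n)) :
    ∃ R : BinaryTree (Fin n), SearchOrdered R ∧ treeKeys R = s := by
  induction s using Finset.induction_on_max with
  | empty => exact ⟨.nil, trivial, rfl⟩
  | insert a s ha ih =>
    obtain ⟨R, hR, hs⟩ := ih
    refine ⟨.node a R .nil, ⟨?_, ?_, hR, trivial⟩, ?_⟩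
    · rw [hs]
      exact ha
    · simp [treeKeys]
    · simp [treeKeys, hs]

/-- Between two keys of equal depth there is a key of smaller depth. -/
theorem exists_between_keyDepth_lt {n : ℕ} (R : BinaryTree (Fin n)) (hR : SearchOrdered R)
    {i j : Fin n} (hi : i ∈ treeKeys R) (hj : j ∈ treeKeys R) (hij : i < j)
    (hd : keyDepth R i = keyDepth R j) :
    ∃ k, i < k ∧ k < j ∧ keyDepth R k < keyDepth R i := by
  induction R with
  | nil => simp [treeKeys] at hi
  | node a l r ihl ihr =>
    obtain ⟨hl, hr, hol, hor⟩ := hR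
    simp only [treeKeys, Finset.mem_insert, Finset.mem_union] at hi hj
    have hia : i ≠ a := by
      rintro rfl
      simp only [keyDepth, if_true, if_neg hij.ne', if_neg hij.not_gt] at hd
      omega
    have hja : j ≠ a := by
      rintro rfl
      simp only [keyDepth, if_true, if_neg hij.ne, if_pos hij] at hd
      omega
    rcases lt_or_gt_of_ne hia with hia' | hia'
    · have hil : i ∈ treeKeys l := by
        rcases hi with h | h | h
        · exact absurd h hia
        · exact h
        · exact absurd (hr _ h) hia'.not_gt
      rcases lt_or_gt_of_ne hja with hja' | hja'
      · have hjl : j ∈ treeKeys l := by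
          rcases hj with h | h | h
          · exact absurd h hja
          · exact h
          · exact absurd (hr _ h) hja'.not_gt
        simp only [keyDepth, if_neg hia, if_neg hja, if_pos hia', if_pos hja'] at hd ⊢
        obtain ⟨k, h1, h2, h3⟩ := ihl hol hil hjl (by omega)
        refine ⟨k, h1, h2, ?_⟩
        rw [if_neg (h2.trans hja').ne, if_pos (h2.trans hja')]
        omega
      -- The root that separates the two keys is the shallower key.
      · refine ⟨a, hia', hja', ?_⟩
        simp only [keyDepth, if_neg hia, if_pos hia', if_true]
        omega
    · have hir : i ∈ treeKeys r := by
        rcases hi with h | h | h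
        · exact absurd h hia
        · exact absurd (hl _ h) hia'.not_gt
        · exact h
      have hja' : a < j := hia'.trans hij
      have hjr : j ∈ treeKeys r := by
        rcases hj with h | h | h
        · exact absurd h hja
        · exact absurd (hl _ h) hja'.not_gt
        · exact h
      simp only [keyDepth, if_neg hia, if_neg hja, if_neg hia'.not_gt, if_neg hja'.not_gt] at hd ⊢
      obtain ⟨k, h1, h2, h3⟩ := ihr hor hir hjr (by omega)
      refine ⟨k, h1, h2, ?_⟩
      rw [if_neg (hia'.trans h1).ne', if_neg (hia'.trans h1).not_gt]
      omega

/-! ### Last touch times and touched keys -/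

section Greedy

variable {n : ℕ} {P : Finset (Fin n × ℕ)} {t : ℕ} {s : Fin n}

theorem lastTouch_le_iff {y : Fin n} {b : WithBot ℕ} :
    lastTouch P y ≤ b ↔ ∀ u, (y, u) ∈ P → (u : WithBot ℕ) ≤ b := by
  simp only [lastTouch, Finset.max_le_iff, Finset.mem_image, Finset.mem_filter, Prod.exists]
  constructor
  · intro h u hu
    exact h u ⟨y, u, ⟨hu, rfl⟩, rfl⟩
  · rintro h u ⟨z, v, ⟨hv, rfl⟩, rfl⟩
    exact h v hv

theorem le_lastTouch {y : Fin n} {u : ℕ} (h : (y, u) ∈ P) : (u : WithBot ℕ) ≤ lastTouch P y :=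
  lastTouch_le_iff.1 le_rfl u h

theorem mem_of_lastTouch_eq {y : Fin n} {u : ℕ} (h : lastTouch P y = u) : (y, u) ∈ P := by
  have := Finset.mem_of_max h
  simp only [Finset.mem_image, Finset.mem_filter, Prod.exists] at this
  obtain ⟨z, v, ⟨hv, rfl⟩, rfl⟩ := this
  exact hv

theorem lastTouch_lt_coe_iff {y : Fin n} {k : ℕ} :
    lastTouch P y < k ↔ ∀ u, (y, u) ∈ P → u < k := by
  constructor
  · intro h u hu
    exact WithBot.coe_lt_coe.1 ((le_lastTouch hu).trans_lt h)
  · intro h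
    rcases hy : lastTouch P y with _ | v
    · exact WithBot.bot_lt_coe k
    · exact WithBot.coe_lt_coe.2 (h v (mem_of_lastTouch_eq hy))

/-- A key other than the accessed one is touched iff it is a strict record of the last touch times
when the keys are scanned from the accessed key. -/
theorem mem_greedyTouched_iff (hP : ∀ p ∈ P, p.2 < t) {y : Fin n} (hy : y ≠ s) :
    y ∈ greedyTouched P t s ↔ ∀ z, min s y ≤ z → z ≤ max s y → z ≠ y →
      lastTouch P z < lastTouch P y := by
  simp only [greedyTouched, Finset.mem_filter, Finset.mem_univ, true_and, hy, false_or, ne_eq,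
    not_false_eq_true]
  constructor
  · rintro ⟨⟨y', k⟩, hp, rfl, hrect⟩ z hz1 hz2 hzy
    refine lt_of_lt_of_le ?_ (le_lastTouch hp)
    rw [lastTouch_lt_coe_iff]
    intro u hu
    by_contra! hku
    have hut : u < t := hP _ hu
    have hkt : k < t := hP _ hp
    rcases hrect (z, u) (Finset.mem_insert_of_mem hu)
      ⟨hz1, hz2, by simp only; omega, by simp only; omega⟩ with h | h
    · exact hut.ne (congrArg Prod.snd h)
    · exact hzy (congrArg Prod.fst h)
  · intro h
    -- Strictness at `s` itself forces `y` to have been touched; its latest point is the witness.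
    have hbot : lastTouch P y ≠ ⊥ :=
      (bot_le.trans_lt (h s (min_le_left _ _) (le_max_left _ _) (Ne.symm hy))).ne'
    obtain ⟨k, hk⟩ := WithBot.ne_bot_iff_exists.1 hbot
    have hp : (y, k) ∈ P := mem_of_lastTouch_eq hk.symm
    refine ⟨(y, k), hp, rfl, ?_⟩
    rintro ⟨z, u⟩ hu ⟨h1, h2, h3, h4⟩
    rcases Finset.mem_insert.1 hu with hu | hu
    · exact Or.inl hu
    · right
      simp only at h1 h2 h3 h4
      have hkt : k < t := hP _ hp
      have hku : k ≤ u := by omega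
      by_cases hzy : z = y
      · subst hzy
        have h5 := le_lastTouch hu
        rw [← hk] at h5
        have h6 : u ≤ k := WithBot.coe_le_coe.1 h5
        rw [le_antisymm h6 hku]
      · have h5 := h z h1 h2 hzy
        rw [← hk] at h5
        exact absurd (lastTouch_lt_coe_iff.1 h5 u hu) hku.not_gt

theorem self_mem_greedyTouched : s ∈ greedyTouched P t s := by
  simp [greedyTouched]

theorem mem_greedyStep {y : Fin n} {u : ℕ} :
    (y, u) ∈ greedyStep P t s ↔ (y, u) ∈ P ∨ (y ∈ greedyTouched P t s ∧ u = t) := by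
  simp only [greedyStep, Finset.mem_union, Finset.mem_image, Prod.mk.injEq]
  grind

theorem greedyStep_time_lt (hP : ∀ p ∈ P, p.2 < t) :
    ∀ p ∈ greedyStep P t s, p.2 < t + 1 := by
  rintro ⟨y, u⟩ hp
  rcases mem_greedyStep.1 hp with h | h
  · exact (hP _ h).trans (Nat.lt_succ_self t)
  · exact h.2 ▸ Nat.lt_succ_self t

theorem lastTouch_greedyStep_of_mem (hP : ∀ p ∈ P, p.2 < t) {y : Fin n}
    (hy : y ∈ greedyTouched P t s) : lastTouch (greedyStep P t s) y = t := by
  apply le_antisymm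
  · rw [lastTouch_le_iff]
    intro u hu
    exact WithBot.coe_le_coe.2 (Nat.lt_succ_iff.1 (greedyStep_time_lt hP _ hu))
  · exact le_lastTouch (mem_greedyStep.2 (Or.inr ⟨hy, rfl⟩))

theorem lastTouch_greedyStep_of_notMem {y : Fin n} (hy : y ∉ greedyTouched P t s) :
    lastTouch (greedyStep P t s) y = lastTouch P y := by
  apply le_antisymm <;> rw [lastTouch_le_iff] <;> intro u hu <;> apply le_lastTouch
  · simpa [mem_greedyStep, hy] using hu
  · exact mem_greedyStep.2 (Or.inl hu)

theorem lastTouch_le_lastTouch_greedyStep (y : Fin n) :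
    lastTouch P y ≤ lastTouch (greedyStep P t s) y :=
  lastTouch_le_iff.2 fun _ hu => le_lastTouch (mem_greedyStep.2 (Or.inl hu))

/-! ### Neighborhoods -/

theorem mem_neighborhood {x z : Fin n} :
    z ∈ neighborhood P x ↔
      ∀ y, min x z ≤ y → y ≤ max x z → y ≠ x → lastTouch P y < lastTouch P x := by
  simp [neighborhood]

theorem self_mem_neighborhood (x : Fin n) : x ∈ neighborhood P x := by
  rw [mem_neighborhood]
  grind

theorem mem_neighborhood_of_between {x p q k : Fin n} (hp : p ∈ neighborhood P x)
    (hq : q ∈ neighborhood P x) (hpk : p ≤ k) (hkq : k ≤ q) : k ∈ neighborhood P x := by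
  rw [mem_neighborhood] at *
  intro y h1 h2 h3
  by_cases h : min x p ≤ y ∧ y ≤ max x p
  · exact hp y h.1 h.2 h3
  · refine hq y ?_ ?_ h3 <;> grind

theorem accessed_mem_neighborhood (hP : ∀ p ∈ P, p.2 < t) {x : Fin n}
    (hx : x ∈ greedyTouched P t s) : s ∈ neighborhood P x := by
  by_cases hxs : x = s
  · rw [hxs]
    exact self_mem_neighborhood s
  · rw [mem_neighborhood, min_comm, max_comm]
    exact (mem_greedyTouched_iff hP hxs).1 hx

/-- The last touch of `x` stays fixed while those of the other keys can only increase. -/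
theorem neighborhood_greedyStep_subset {x : Fin n} (hx : x ∉ greedyTouched P t s) :
    neighborhood (greedyStep P t s) x ⊆ neighborhood P x := by
  intro z hz
  rw [mem_neighborhood] at *
  intro y h1 h2 h3
  have := hz y h1 h2 h3
  rw [lastTouch_greedyStep_of_notMem hx] at this
  exact (lastTouch_le_lastTouch_greedyStep y).trans_lt this

/-- After the access, the neighborhood of a touched key does not reach another touched key. -/
theorem notMem_greedyTouched_of_mem_neighborhood (hP : ∀ p ∈ P, p.2 < t) {x z y : Fin n}
    (hx : x ∈ greedyTouched P t s) (hz : z ∈ neighborhood (greedyStep P t s) x)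
    (h1 : min x z ≤ y) (h2 : y ≤ max x z) (h3 : y ≠ x) : y ∉ greedyTouched P t s := by
  intro hy
  have := mem_neighborhood.1 hz y h1 h2 h3
  rw [lastTouch_greedyStep_of_mem hP hx, lastTouch_greedyStep_of_mem hP hy] at this
  exact lt_irrefl _ this

/-- If no key other than `s` between `s` and `z` is touched, then these keys were last touched
no later than `s`. -/
theorem lastTouch_le_of_notMem_greedyTouched (hP : ∀ p ∈ P, p.2 < t) {z : Fin n}
    (h : ∀ y, min s z ≤ y → y ≤ max s z → y ≠ s → y ∉ greedyTouched P t s) :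
    lastTouch P z ≤ lastTouch P s := by
  -- With truncated subtraction this is the distance from `s` to `z`. The nearest key touched later
  -- than `s` would be a strict record, hence touched.
  induction hd : (z : ℕ) - s + (s - z) using Nat.strong_induction_on generalizing z with
  | _ d ih =>
    by_cases hzs : z = s
    · rw [hzs]
    by_contra! hlt
    refine h z (min_le_right _ _) (le_max_right _ _) hzs ((mem_greedyTouched_iff hP hzs).2 ?_)
    intro y h1 h2 h3
    refine lt_of_le_of_lt (ih ((y : ℕ) - s + (s - y)) ?_ (z := y) ?_ rfl) hlt
    · grind
    · intro w hw1 hw2 hw3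
      refine h w ?_ ?_ hw3 <;> grind

/-! ### The key inequality -/

variable {R : BinaryTree (Fin n)}

theorem keyPotential_nonpos (x : Fin n) : keyPotential R P x ≤ 0 := by
  unfold keyPotential
  omega

theorem le_keyPotential {x z : Fin n} (hz : z ∈ neighborhood P x) :
    -2 * (keyDepth R z : ℤ) ≤ keyPotential R P x := by
  have := Finset.inf'_le (keyDepth R) hz
  unfold keyPotential
  omega

theorem exists_keyPotential_eq (x : Fin n) :
    ∃ z ∈ neighborhood P x, keyPotential R P x = -2 * (keyDepth R z : ℤ) := by
  obtain ⟨z, hz, h⟩ := Finset.exists_mem_eq_inf' (neighborhood_nonempty P x) (keyDepth R)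
  exact ⟨z, hz, by rw [keyPotential, h]⟩

theorem keyPotential_greedyStep_le {x : Fin n} (hx : x ∉ greedyTouched P t s) :
    keyPotential R (greedyStep P t s) x ≤ keyPotential R P x := by
  obtain ⟨z, hz, h⟩ := exists_keyPotential_eq (R := R) (P := greedyStep P t s) x
  rw [h]
  exact le_keyPotential (neighborhood_greedyStep_subset hx hz)

/-- The key inequality for touched keys `a`, `m`, `c`, `b` listed by increasing distance from
the accessed key `s`, all on the same side of it. -/
theorem keyPotential_inequality (hR : IsBSTOn n R) (hP : ∀ p ∈ P, p.2 < t) {a m c b : Fin n}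
    (ha : a ∈ greedyTouched P t s) (hm : m ∈ greedyTouched P t s)
    (hc : c ∈ greedyTouched P t s) (hb : b ∈ greedyTouched P t s)
    (hord : (s ≤ a ∧ a < m ∧ m < c ∧ c < b) ∨ (b < c ∧ c < m ∧ m < a ∧ a ≤ s)) :
    2 + keyPotential R (greedyStep P t s) a + keyPotential R (greedyStep P t s) c
      ≤ 2 * keyPotential R P b := by
  have hbs : b ≠ s := by grind
  have hrec := (mem_greedyTouched_iff hP hbs).1 hb
  have key : ∀ z, min s b ≤ z → z ≤ max s b → z ∈ neighborhood P b := by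
    intro z h1 h2
    rw [mem_neighborhood]
    intro y h3 h4 h5
    refine hrec y ?_ ?_ h5 <;> grind
  obtain ⟨p, hp, hpe⟩ := exists_keyPotential_eq (R := R) (P := greedyStep P t s) a
  obtain ⟨q, hq, hqe⟩ := exists_keyPotential_eq (R := R) (P := greedyStep P t s) c
  have hpm : ¬(min a p ≤ m ∧ m ≤ max a p) := fun h =>
    notMem_greedyTouched_of_mem_neighborhood hP ha hp h.1 h.2 (by grind) hm
  have hqm : ¬(min c q ≤ m ∧ m ≤ max c q) := fun h =>
    notMem_greedyTouched_of_mem_neighborhood hP hc hq h.1 h.2 (by grind) hm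
  have hqb : ¬(min c q ≤ b ∧ b ≤ max c q) := fun h =>
    notMem_greedyTouched_of_mem_neighborhood hP hc hq h.1 h.2 (by grind) hb
  -- `p` stays on the `s` side of `m`, while `q` lies strictly between `m` and `b`.
  have hpq : p ≠ q := by grind
  have hqN : q ∈ neighborhood P b := by apply key <;> grind
  have hpN : p ∈ neighborhood P b := by
    by_cases h : min s b ≤ p ∧ p ≤ max s b
    · exact key p h.1 h.2
    -- If `p` lies beyond `s`, the new neighborhood of `a` reaches across the touched key `s`, so
    -- `a` is `s`. The keys from there to `p` are untouched, hence last touched no later than `s`,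
    -- which precedes `b`.
    have has : a = s := by
      by_contra hne
      exact notMem_greedyTouched_of_mem_neighborhood hP ha hp (y := s) (by grind) (by grind)
        (Ne.symm hne) self_mem_greedyTouched
    subst has
    have hsb := hrec a (min_le_left _ _) (le_max_left _ _) (Ne.symm hbs)
    rw [mem_neighborhood]
    intro y h1 h2 h3
    by_cases h4 : min a b ≤ y ∧ y ≤ max a b
    · exact hrec y h4.1 h4.2 h3
    · refine lt_of_le_of_lt (lastTouch_le_of_notMem_greedyTouched hP ?_) hsb
      intro w hw1 hw2 hw3
      refine notMem_greedyTouched_of_mem_neighborhood hP ha hp (y := w) ?_ ?_ hw3 <;> grind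
  have h1 := le_keyPotential (R := R) hpN
  have h2 := le_keyPotential (R := R) hqN
  obtain ⟨z, hz, hze⟩ := exists_keyPotential_eq (R := R) (P := P) b
  by_contra! hlt
  have hd : keyDepth R p = keyDepth R q := by omega
  have hmem : ∀ x, x ∈ treeKeys R := fun x => hR.2 ▸ Finset.mem_univ x
  rcases lt_or_gt_of_ne hpq with h | h
  · obtain ⟨k, hk1, hk2, hk3⟩ := exists_between_keyDepth_lt R hR.1 (hmem p) (hmem q) h hd
    have := le_keyPotential (R := R) (mem_neighborhood_of_between hpN hqN hk1.le hk2.le)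
    omega
  · obtain ⟨k, hk1, hk2, hk3⟩ := exists_between_keyDepth_lt R hR.1 (hmem q) (hmem p) h hd.symm
    have := le_keyPotential (R := R) (mem_neighborhood_of_between hqN hpN hk1.le hk2.le)
    omega

/-! ### Touched keys on each side as ordered lists -/

theorem mem_touchedRight {y : Fin n} :
    y ∈ touchedRight P t s ↔ y ∈ greedyTouched P t s ∧ s ≤ y := by
  simp [touchedRight]

theorem mem_touchedLeft {y : Fin n} :
    y ∈ touchedLeft P t s ↔ y ∈ greedyTouched P t s ∧ y ≤ s := by
  simp [touchedLeft]

theorem touchedRight_getElem_lt {i j : ℕ} (hij : i < j) (hj : j < (touchedRight P t s).length) :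
    (touchedRight P t s)[i] < (touchedRight P t s)[j] := by
  have h : (touchedRight P t s).Pairwise (· < ·) := (Finset.sortedLT_sort _).pairwise
  exact List.pairwise_iff_getElem.1 h i j _ hj hij

theorem touchedLeft_getElem_lt {i j : ℕ} (hij : i < j) (hj : j < (touchedLeft P t s).length) :
    (touchedLeft P t s)[j] < (touchedLeft P t s)[i] := by
  have h1 : (touchedLeft P t s).Pairwise (· ≥ ·) := Finset.pairwise_sort _ _
  have h2 : (touchedLeft P t s).Nodup := Finset.sort_nodup _ _
  refine lt_of_le_of_ne (List.pairwise_iff_getElem.1 h1 i j _ hj hij) ?_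
  exact (List.pairwise_iff_getElem.1 h2 i j _ hj hij).symm

theorem keyPotential_inequality_right (hR : IsBSTOn n R) (hP : ∀ p ∈ P, p.2 < t) (i : ℕ)
    (h₀ : i < (touchedRight P t s).length) (h₂ : i + 2 < (touchedRight P t s).length)
    (h : i + 3 < (touchedRight P t s).length) :
    2 + keyPotential R (greedyStep P t s) ((touchedRight P t s)[i])
        + keyPotential R (greedyStep P t s) ((touchedRight P t s)[i + 2])
      ≤ 2 * keyPotential R P ((touchedRight P t s)[i + 3]) := by
  have hmem : ∀ (j : ℕ) (hj : j < (touchedRight P t s).length),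
      (touchedRight P t s)[j] ∈ greedyTouched P t s ∧ s ≤ (touchedRight P t s)[j] :=
    fun j hj => mem_touchedRight.1 (List.getElem_mem hj)
  exact keyPotential_inequality hR hP (hmem i (by omega)).1 (hmem (i + 1) (by omega)).1
    (hmem (i + 2) (by omega)).1 (hmem (i + 3) h).1
    (Or.inl ⟨(hmem i (by omega)).2, touchedRight_getElem_lt (by omega) _,
      touchedRight_getElem_lt (by omega) _, touchedRight_getElem_lt (by omega) _⟩)

theorem keyPotential_inequality_left (hR : IsBSTOn n R) (hP : ∀ p ∈ P, p.2 < t) (i : ℕ)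
    (h₀ : i < (touchedLeft P t s).length) (h₂ : i + 2 < (touchedLeft P t s).length)
    (h : i + 3 < (touchedLeft P t s).length) :
    2 + keyPotential R (greedyStep P t s) ((touchedLeft P t s)[i])
        + keyPotential R (greedyStep P t s) ((touchedLeft P t s)[i + 2])
      ≤ 2 * keyPotential R P ((touchedLeft P t s)[i + 3]) := by
  have hmem : ∀ (j : ℕ) (hj : j < (touchedLeft P t s).length),
      (touchedLeft P t s)[j] ∈ greedyTouched P t s ∧ (touchedLeft P t s)[j] ≤ s :=
    fun j hj => mem_touchedLeft.1 (List.getElem_mem hj)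
  exact keyPotential_inequality hR hP (hmem i (by omega)).1 (hmem (i + 1) (by omega)).1
    (hmem (i + 2) (by omega)).1 (hmem (i + 3) h).1
    (Or.inr ⟨touchedLeft_getElem_lt (by omega) _, touchedLeft_getElem_lt (by omega) _,
      touchedLeft_getElem_lt (by omega) _, (hmem i (by omega)).2⟩)

end Greedy

/-! ### The amortized cost of an access -/

/-- Here `a` and `b` play the new and old potentials along one side. Doubling the sum lets each `b
(i + 3)` pay for one copy of `a i` and one of `a (i + 2)`; only `b 0`, `b 1`, `b 2` need the bound
by `d`. -/
theorem sum_range_sub_le_of_telescoping {N : ℕ} {d : ℤ} (a b : ℕ → ℤ)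
    (ha : ∀ i < N, a i ≤ 0) (hb : ∀ i < N, -2 * d ≤ b i) (hd : 0 ≤ d)
    (h : ∀ i, i + 3 < N → 2 + a i + a (i + 2) ≤ 2 * b (i + 3)) :
    ∑ i ∈ Finset.range N, (1 + a i - b i) ≤ 6 * d + 3 := by
  -- The trailing terms are the copies of `a` kept for later inequalities: one each at `M` and `M +
  -- 1`, two at `M + 2`.
  have strong : ∀ M, M + 3 ≤ N →
      2 * ∑ i ∈ Finset.range (M + 3), (1 + a i - b i)
        ≤ 12 * d + 6 + a M + a (M + 1) + 2 * a (M + 2) := by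
    intro M
    induction M with
    | zero =>
      intro hN
      have := ha 0 (by omega)
      have := ha 1 (by omega)
      have := hb 0 (by omega)
      have := hb 1 (by omega)
      have := hb 2 (by omega)
      simp only [Finset.sum_range_succ, Finset.sum_range_zero]
      norm_num
      linarith
    | succ M ih =>
      intro hN
      have h1 := ih (by omega)
      have h2 := h M (by omega)
      rw [show M + 1 + 3 = M + 3 + 1 by ring, Finset.sum_range_succ,
        show M + 1 + 2 = M + 3 by ring, show M + 1 + 1 = M + 2 by ring]
      linarith
  by_cases hN : 3 ≤ N
  · obtain ⟨M, rfl⟩ := Nat.exists_eq_add_of_le' hN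
    have := strong M le_rfl
    have := ha M (by omega)
    have := ha (M + 1) (by omega)
    have := ha (M + 2) (by omega)
    linarith
  · calc ∑ i ∈ Finset.range N, (1 + a i - b i)
        ≤ ∑ _i ∈ Finset.range N, (1 + 2 * d) := by
          refine Finset.sum_le_sum fun i hi => ?_
          have := ha i (Finset.mem_range.1 hi)
          have := hb i (Finset.mem_range.1 hi)
          linarith
      _ = N * (1 + 2 * d) := by simp
      _ ≤ 3 * (1 + 2 * d) := by
          refine mul_le_mul_of_nonneg_right ?_ (by omega)
          omega
      _ = 6 * d + 3 := by ring

theorem list_sum_sub_le_of_telescoping {α : Type*} (l : List α) {d : ℤ} (a b : α → ℤ)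
    (ha : ∀ x ∈ l, a x ≤ 0) (hb : ∀ x ∈ l, -2 * d ≤ b x) (hd : 0 ≤ d)
    (h : ∀ (i : ℕ) (_ : i + 3 < l.length), 2 + a l[i] + a l[i + 2] ≤ 2 * b l[i + 3]) :
    (l.map fun x => 1 + a x - b x).sum ≤ 6 * d + 3 := by
  -- `x₀` is only the default of `getD`; every index used is in range.
  rcases l.eq_nil_or_concat with rfl | ⟨_, x₀, -⟩
  · simp only [List.map_nil, List.sum_nil]
    omega
  have hget : ∀ i (hi : i < l.length), l.getD i x₀ = l[i] := fun i hi => by simp [hi]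
  have := sum_range_sub_le_of_telescoping (N := l.length) (d := d)
    (fun i => a (l.getD i x₀)) (fun i => b (l.getD i x₀))
    (fun i hi => by
      simp only [hget i hi]
      exact ha _ (List.getElem_mem hi))
    (fun i hi => by
      simp only [hget i hi]
      exact hb _ (List.getElem_mem hi)) hd
    (fun i hi => by
      simp only [hget i (by omega), hget (i + 2) (by omega), hget (i + 3) hi]
      exact h i hi)
  refine le_trans (le_of_eq ?_) this
  rw [← Fin.sum_univ_fun_getElem, Finset.sum_range]
  refine Finset.sum_congr rfl fun i _ => ?_
  simp only [hget i i.2]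

section Amortized

variable {n : ℕ} {P : Finset (Fin n × ℕ)} {t : ℕ} {s : Fin n} {R : BinaryTree (Fin n)}

theorem sum_map_touchedRight (f : Fin n → ℤ) :
    ((touchedRight P t s).map f).sum = ∑ x ∈ (greedyTouched P t s).filter (s ≤ ·), f x := by
  rw [touchedRight, ← List.sum_toFinset f (Finset.sort_nodup _ _), Finset.sort_toFinset]

theorem sum_map_touchedLeft (f : Fin n → ℤ) :
    ((touchedLeft P t s).map f).sum = ∑ x ∈ (greedyTouched P t s).filter (· ≤ s), f x := by
  rw [touchedLeft, ← List.sum_toFinset f (Finset.sort_nodup _ _), Finset.sort_toFinset]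

theorem amortized_greedy_le (hR : IsBSTOn n R) (hP : ∀ p ∈ P, p.2 < t) :
    ((greedyTouched P t s).card : ℤ)
        + minDepthPotential R (greedyStep P t s) - minDepthPotential R P
      ≤ 14 * (1 + (keyDepth R s : ℤ)) := by
  set f : Fin n → ℤ := fun x => 1 + keyPotential R (greedyStep P t s) x - keyPotential R P x
    with hf
  have hlow : ∀ x ∈ greedyTouched P t s, -2 * (keyDepth R s : ℤ) ≤ keyPotential R P x :=
    fun x hx => le_keyPotential (accessed_mem_neighborhood hP hx)
  have hright : ∑ x ∈ (greedyTouched P t s).filter (s ≤ ·), f x ≤ 6 * (keyDepth R s : ℤ) + 3 := by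
    rw [← sum_map_touchedRight]
    exact list_sum_sub_le_of_telescoping _ _ _ (fun x _ => keyPotential_nonpos x)
      (fun x hx => hlow x (mem_touchedRight.1 hx).1) (by omega)
      (fun i h => keyPotential_inequality_right hR hP i (by omega) (by omega) h)
  have hleft : ∑ x ∈ (greedyTouched P t s).filter (· ≤ s), f x ≤ 6 * (keyDepth R s : ℤ) + 3 := by
    rw [← sum_map_touchedLeft]
    exact list_sum_sub_le_of_telescoping _ _ _ (fun x _ => keyPotential_nonpos x)
      (fun x hx => hlow x (mem_touchedLeft.1 hx).1) (by omega)
      (fun i h => keyPotential_inequality_left hR hP i (by omega) (by omega) h)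
  -- `s` is counted on both sides. As `f s` is at least `1 - 2 d(s)`, the total is at most `14 d(s)
  -- + 5`, whence the constant 14.
  have hsplit : ∑ x ∈ greedyTouched P t s, f x + f s
      = ∑ x ∈ (greedyTouched P t s).filter (s ≤ ·), f x
        + ∑ x ∈ (greedyTouched P t s).filter (· ≤ s), f x := by
    rw [← Finset.sum_union_inter, ← Finset.filter_or, ← Finset.filter_and]
    congr 1
    · rw [Finset.filter_true_of_mem fun x _ => le_total s x]
    · rw [show (greedyTouched P t s).filter (fun x => s ≤ x ∧ x ≤ s) = {s} from ?_,
        Finset.sum_singleton]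
      ext x
      simp only [Finset.mem_filter, Finset.mem_singleton]
      exact ⟨fun h => le_antisymm h.2.2 h.2.1,
        fun h => ⟨h ▸ self_mem_greedyTouched, h.ge, h.le⟩⟩
  have hs : -2 * (keyDepth R s : ℤ) + 1 ≤ f s := by
    have h1 := le_keyPotential (R := R) (self_mem_neighborhood (P := greedyStep P t s) s)
    have h2 := keyPotential_nonpos (R := R) (P := P) s
    simp only [hf]
    linarith
  have htotal : ((greedyTouched P t s).card : ℤ)
      + minDepthPotential R (greedyStep P t s) - minDepthPotential R P
      ≤ ∑ x ∈ greedyTouched P t s, f x := by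
    have hmono : minDepthPotential R (greedyStep P t s) - minDepthPotential R P
        ≤ ∑ x ∈ greedyTouched P t s,
          (keyPotential R (greedyStep P t s) x - keyPotential R P x) := by
      rw [minDepthPotential, minDepthPotential, ← Finset.sum_sub_distrib,
        ← Finset.sum_add_sum_compl (greedyTouched P t s)]
      have : ∑ x ∈ (greedyTouched P t s)ᶜ,
          (keyPotential R (greedyStep P t s) x - keyPotential R P x) ≤ 0 :=
        Finset.sum_nonpos fun x hx =>
          sub_nonpos.2 (keyPotential_greedyStep_le (Finset.mem_compl.1 hx))
      linarith
    have hcard : ∑ x ∈ greedyTouched P t s, f x = ((greedyTouched P t s).card : ℤ)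
        + ∑ x ∈ greedyTouched P t s,
          (keyPotential R (greedyStep P t s) x - keyPotential R P x) := by
      simp only [hf, add_sub_assoc, Finset.sum_add_distrib, Finset.sum_const, nsmul_eq_mul,
        mul_one]
    linarith
  linarith

/-! ### Static optimality -/

theorem minDepthPotential_nonpos : minDepthPotential R P ≤ 0 :=
  Finset.sum_nonpos fun x _ => keyPotential_nonpos x

theorem le_minDepthPotential : -(2 * ∑ x, (keyDepth R x : ℤ)) ≤ minDepthPotential R P := by
  rw [minDepthPotential, Finset.mul_sum, ← Finset.sum_neg_distrib]
  refine Finset.sum_le_sum fun x _ => ?_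
  have := le_keyPotential (R := R) (self_mem_neighborhood (P := P) x)
  linarith

/-- All last touches are `⊥`, so neighborhoods are singletons. The potential is then the least
possible and cancels the additive term for the empty start. -/
theorem minDepthPotential_empty :
    minDepthPotential R (∅ : Finset (Fin n × ℕ)) = -(2 * ∑ x, (keyDepth R x : ℤ)) := by
  rw [minDepthPotential, Finset.mul_sum, ← Finset.sum_neg_distrib]
  refine Finset.sum_congr rfl fun x _ => ?_
  obtain ⟨z, hz, h⟩ := exists_keyPotential_eq (R := R) (P := ∅) x
  have hzx : z = x := by
    by_contra hne
    exact lt_irrefl _ (mem_neighborhood.1 hz z (min_le_right _ _) (le_max_right _ _) hne)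
  rw [h, hzx]
  ring

theorem greedyCost_le_add_minDepthPotential (hR : IsBSTOn n R) (S : List (Fin n)) :
    ∀ (P : Finset (Fin n × ℕ)) (t : ℕ), (∀ p ∈ P, p.2 < t) →
      (greedyCost P t S : ℤ) ≤ 14 * (S.length + staticCost R S)
        + minDepthPotential R P + 2 * ∑ x, (keyDepth R x : ℤ) := by
  induction S with
  | nil =>
    intro P t _
    have := le_minDepthPotential (R := R) (P := P)
    simp only [greedyCost, staticCost, List.length_nil, List.map_nil, List.sum_nil]
    push_cast
    linarith
  | cons s S ih =>
    intro P t hP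
    have h1 := ih (greedyStep P t s) (t + 1) (greedyStep_time_lt hP)
    have h2 := amortized_greedy_le (s := s) hR hP
    simp only [greedyCost, staticCost, List.length_cons, List.map_cons, List.sum_cons] at h1 ⊢
    push_cast at h1 ⊢
    linarith

end Amortized

theorem mainTheorem11 :
    ∃ C : ℕ, ∀ n : ℕ,
      -- the amortized cost of every single access, and the key inequality on both sides
      (∀ R : BinaryTree (Fin n), IsBSTOn n R →
        ∀ (P : Finset (Fin n × ℕ)) (t : ℕ), (∀ p ∈ P, p.2 < t) → ∀ s : Fin n,
          ((greedyTouched P t s).card : ℤ)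
              + minDepthPotential R (greedyStep P t s) - minDepthPotential R P
            ≤ C * (1 + (keyDepth R s : ℤ)) ∧
          (∀ (i : ℕ) (h : i + 3 < (touchedRight P t s).length),
            2 + keyPotential R (greedyStep P t s) ((touchedRight P t s)[i])
                + keyPotential R (greedyStep P t s) ((touchedRight P t s)[i + 2])
              ≤ 2 * keyPotential R P ((touchedRight P t s)[i + 3])) ∧
          (∀ (i : ℕ) (h : i + 3 < (touchedLeft P t s).length),
            2 + keyPotential R (greedyStep P t s) ((touchedLeft P t s)[i])
                + keyPotential R (greedyStep P t s) ((touchedLeft P t s)[i + 2])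
              ≤ 2 * keyPotential R P ((touchedLeft P t s)[i + 3]))) ∧
      -- static optimality from an arbitrary initial configuration
      (∀ R : BinaryTree (Fin n), IsBSTOn n R →
        ∀ (P : Finset (Fin n × ℕ)) (t : ℕ), (∀ p ∈ P, p.2 < t) → ∀ S : List (Fin n),
          greedyCost P t S
            ≤ C * (S.length + staticCost R S) + 2 * ∑ x : Fin n, keyDepth R x) ∧
      -- static optimality from the empty configuration
      (∀ (t : ℕ) (S : List (Fin n)),
        greedyCost (∅ : Finset (Fin n × ℕ)) t S ≤ C * (S.length + staticOpt S)) := by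
  refine ⟨14, fun n => ⟨fun R hR P t hP s => ⟨?_,
    fun i h => keyPotential_inequality_right hR hP i (by omega) (by omega) h,
    fun i h => keyPotential_inequality_left hR hP i (by omega) (by omega) h⟩, fun R hR P t hP S => ?_, fun t S => ?_⟩⟩
  · exact_mod_cast amortized_greedy_le hR hP
  · have h1 := greedyCost_le_add_minDepthPotential hR S P t hP
    have h2 := minDepthPotential_nonpos (R := R) (P := P)
    zify
    linarith
  · obtain ⟨R₀, hR₀⟩ := exists_bst_of_finset (Finset.univ : Finset (Fin n))
    -- Nonemptiness makes the infimum attained, so one optimal tree serves as reference.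
    have hne : {c | ∃ R : BinaryTree (Fin n), IsBSTOn n R ∧ c = staticCost R S}.Nonempty :=
      ⟨_, R₀, hR₀, rfl⟩
    obtain ⟨R, hR, hopt⟩ := Nat.sInf_mem hne
    have h1 := greedyCost_le_add_minDepthPotential hR S ∅ t (by simp)
    rw [minDepthPotential_empty] at h1
    rw [staticOpt, hopt]
    zify
    linarith
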